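/- Let $\mathcal E$ be a Grothendieck topos, i.e. a category equivalent to the category of sheaves of sets on a small site. Let $\mathrm{Mono}$ be the class of monomorphisms of $\mathcal E$ and $\mathrm{Mono}^{\square}$ the class of maps having the right lifting property against all monomorphisms. A cylinder $(\mathrm{cyl},\gamma,\sigma)$ for $(\mathrm{Mono},\mathrm{Mono}^{\square})$ is a functor $\mathrm{cyl}\colon\mathcal E\to\mathcal E$ with natural maps $\gamma_X\colon X+X\to\mathrm{cyl}\,X$ and $\sigma_X\colon\mathrm{cyl}\,X\to X$ such that each $\gamma_X$ is a monomorphism and $\sigma_X\circ\gamma_X$ is the codiagonal $X+X\to X$. Write $\gamma^0_X,\gamma^1_X\colon X\to\mathrm{cyl}\,X$ for the composites of $\gamma_X$ with the two coproduct inclusions $X\to X+X$. For a natural map $\alpha\colon F\to F'$ of functors and a map $f\colon X\to Y$, let $$f\star\alpha\colon FY\sqcup_{FX}F'X\to F'Y$$ be the map out of the pushout of $Ff$ and $\alpha_X$ that is induced by $\alpha_Y$ and $F'f$. The cylinder is called cartesian if $\mathrm{cyl}$ is a left adjoint and, for every monomorphism $f$, the maps $f\star\gamma$, $f\star\gamma^0$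 and $f\star\gamma^1$ are monomorphisms. Consider the conditions: - (DH1) The functor $\mathrm{cyl}$ preserves monomorphisms and all small colimits. - (DH2) For every monomorphism $f\colon X\to Y$ and $k=0,1$, the square formed by $\gamma^k_X\colon X\to\mathrm{cyl}\,X$, $f$, $\mathrm{cyl}\,f$ and $\gamma^k_Y\colon Y\to\mathrm{cyl}\,Y$ is a pullback. - (DH3) For every monomorphism $f\colon X\to Y$, the square formed by $\gamma_X\colon X+X\to\mathrm{cyl}\,X$, $f+f$, $\mathrm{cyl}\,f$ and $\gamma_Y\colon Y+Y\to\mathrm{cyl}\,Y$ is a pullback. Then a cylinder for $(\mathrm{Mono},\mathrm{Mono}^{\square})$ in $\mathcal E$ is cartesian if and only if it satisfies DH1. In that case it also satisfies DH2 and DH3. -/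

import Mathlib

open CategoryTheory CategoryTheory.Limits

universe v u

/-- A Grothendieck topos: a category (with hom-sets in `Type v`) equivalent to the category
of sheaves of sets on some `v`-small site. -/
class IsGrothendieckTopos (E : Type u) [Category.{v} E] : Prop where
  exists_equivalence_sheaf :
    ∃ (C : Type v) (_ : SmallCategory C) (J : GrothendieckTopology C),
      Nonempty (E ≌ Sheaf J (Type v))

/-- A Grothendieck topos is cocomplete, so coproducts and pushouts below make sense. -/
instance IsGrothendieckTopos.hasColimits (E : Type u) [Category.{v} E]
    [IsGrothendieckTopos.{v, u} E] : HasColimits E := by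
  obtain ⟨C, _, J, ⟨e⟩⟩ := IsGrothendieckTopos.exists_equivalence_sheaf (E := E)
  have : HasColimitsOfSize.{v, v} (Sheaf J (Type v)) := ⟨fun _ _ => inferInstance⟩
  exact Adjunction.has_colimits_of_equivalence e.functor

namespace CylinderTheory

noncomputable section

variable {K : Type u} [Category.{v} K]

/-- For a natural map `α : F ⟶ F'` and `f : X ⟶ Y`, the connecting map
`f ⋆ α : FY ⊔_{FX} F'X ⟶ F'Y` out of the pushout, induced by `α_Y` and `F' f`. -/
def starMap {A : Type*} [Category* A] [HasPushouts A] {F F' : K ⥤ A} {X Y : K}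
    (f : X ⟶ Y) (α : F ⟶ F') : pushout (F.map f) (α.app X) ⟶ F'.obj Y :=
  pushout.desc (α.app Y) (F'.map f) (α.naturality f)

/-- `StarStable L α` says `L ⋆ α ⊆ L`. -/
def StarStable [HasPushouts K] (L : MorphismProperty K) {F F' : K ⥤ K} (α : F ⟶ F') : Prop :=
  ∀ ⦃X Y : K⦄ (f : X ⟶ Y), L f → L (starMap f α)

variable [HasBinaryCoproducts K]

/-- The functor `X ↦ X + X`, `f ↦ f + f`. -/
@[simps]
def doubling (K : Type u) [Category.{v} K] [HasBinaryCoproducts K] : K ⥤ K where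
  obj X := X ⨿ X
  map f := coprod.map f f

/-- The first coproduct inclusion `ι⁰_X : X ⟶ X + X`, as a natural map. -/
@[simps]
def ι₀ (K : Type u) [Category.{v} K] [HasBinaryCoproducts K] : 𝟭 K ⟶ doubling K where
  app X := (coprod.inl : X ⟶ X ⨿ X)
  naturality _ _ f := (coprod.inl_map f f).symm

/-- The second coproduct inclusion `ι¹_X : X ⟶ X + X`, as a natural map. -/
@[simps]
def ι₁ (K : Type u) [Category.{v} K] [HasBinaryCoproducts K] : 𝟭 K ⟶ doubling K where
  app X := (coprod.inr : X ⟶ X ⨿ X)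
  naturality _ _ f := (coprod.inr_map f f).symm

/-- A functorial cylinder with respect to classes `C` (cofibrations) and `W` (weak equivalences):
a functor `cyl` with natural maps `γ_X : X + X ⟶ cyl X` in `C` and `σ_X : cyl X ⟶ X` in `W`
whose composite is the codiagonal. -/
structure FunctorialCylinder (C W : MorphismProperty K) where
  cyl : K ⥤ K
  γ : doubling K ⟶ cyl
  σ : cyl ⟶ 𝟭 K
  γ_mem (X : K) : C (γ.app X)
  σ_mem (X : K) : W (σ.app X)
  fac (X : K) : γ.app X ≫ σ.app X = coprod.desc (𝟙 X) (𝟙 X)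

/-- A functorial cylinder for a weak factorization system `(L, R)` is one for the trivial model
structure with cofibrations `L`, fibrations `R`, and all maps as weak equivalences. -/
abbrev WFSCylinder (L _R : MorphismProperty K) := FunctorialCylinder L (⊤ : MorphismProperty K)

namespace FunctorialCylinder

variable {C W : MorphismProperty K} (Z : FunctorialCylinder C W)

/-- `γ⁰_X : X ⟶ cyl X`. -/
def γ₀ : 𝟭 K ⟶ Z.cyl := ι₀ K ≫ Z.γ

/-- `γ¹_X : X ⟶ cyl X`. -/
def γ₁ : 𝟭 K ⟶ Z.cyl := ι₁ K ≫ Z.γ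

/-- A cylinder is cartesian if the cylinder functor is a left adjoint and the class of cofibrations
is stable under `- ⋆ γ`, `- ⋆ γ⁰` and `- ⋆ γ¹`. -/
structure IsCartesian [HasPushouts K] : Prop where
  isLeftAdjoint : Z.cyl.IsLeftAdjoint
  star_γ : StarStable C Z.γ
  star_γ₀ : StarStable C Z.γ₀
  star_γ₁ : StarStable C Z.γ₁

/-- The cylinder functor preserves monomorphisms and all (small) colimits. -/
structure DH1 : Prop where
  preservesMonomorphisms : Z.cyl.PreservesMonomorphisms
  preservesColimits : PreservesColimits Z.cyl

/-- The naturality squares of `γ⁰` and `γ¹` at monomorphisms are pullback squares. -/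
def DH2 : Prop :=
  ∀ ⦃X Y : K⦄ (f : X ⟶ Y), Mono f →
    IsPullback (Z.γ₀.app X) f (Z.cyl.map f) (Z.γ₀.app Y) ∧
    IsPullback (Z.γ₁.app X) f (Z.cyl.map f) (Z.γ₁.app Y)

/-- The naturality squares of `γ` at monomorphisms are pullback squares. -/
def DH3 : Prop :=
  ∀ ⦃X Y : K⦄ (f : X ⟶ Y), Mono f →
    IsPullback (Z.γ.app X) ((doubling K).map f) (Z.cyl.map f) (Z.γ.app Y)

end FunctorialCylinder

end

end CylinderTheory

/-! A topos is adhesive, and DH2, DH3 need only that `cyl` preserves monomorphisms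
(`Adhesive.isPullback_naturality`): a generalized element of `FY` landing in `GX` is equalized by
the two maps to `F(Y ⊔_X Y)`, because `α` is monic there, and so lies in `FX`. Given these
pullbacks, `f ⋆ α` includes a union of two subobjects, and unions in an adhesive category are
pushouts over the intersection. Left adjointness corresponds to cocontinuity by an adjoint functor
theorem obtained from presheaves. -/

namespace CategoryTheory

section LeftAdjoint

universe v₁ v₂ v₃ u₁ u₂ u₃

/-- A functor out of a reflective subcategory is a left adjoint as soon as its composite with
the reflector is one. -/
theorem Functor.isLeftAdjoint_of_reflector_comp {P : Type u₁} {A : Type u₂} {B : Type u₃}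
    [Category.{v₁} P] [Category.{v₂} A] [Category.{v₃} B] {L : P ⥤ A} {i : A ⥤ P}
    (adj : L ⊣ i) [i.Full] [i.Faithful] (F : A ⥤ B) [hF : (L ⋙ F).IsLeftAdjoint] :
    F.IsLeftAdjoint := by
  obtain ⟨R, ⟨adj'⟩⟩ := hF
  let _ : Reflective i := ⟨L, adj⟩
  -- The unit at `R.obj e` has a retraction, the transpose of `F.map` of the counit of `adj`
  -- followed by the counit of `adj'`. So `R` takes values in the subcategory, and `adj'` restricts
  -- to it.
  have key (e : B) : i.essImage (R.obj e) := by
    have h : adj.unit.app (R.obj e) ≫ adj'.homEquiv (i.obj (L.obj (R.obj e))) e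
        (F.map (adj.counit.app (L.obj (R.obj e))) ≫ adj'.counit.app e) = 𝟙 (R.obj e) := by
      have h' := adj'.homEquiv_naturality_left (adj.unit.app (R.obj e))
        (F.map (adj.counit.app (L.obj (R.obj e))) ≫ adj'.counit.app e)
      refine h'.symm.trans ((adj'.homEquiv _ _).symm.injective ?_)
      simp [← F.map_comp_assoc, Adjunction.homEquiv_counit]
    have : IsSplitMono ((reflectorAdjunction i).unit.app (R.obj e)) := ⟨⟨_, h⟩⟩
    exact mem_essImage_of_unit_isSplitMono
  have (e : B) : IsIso (adj.unit.app (R.obj e)) := Functor.essImage.unit_isIso (key e)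
  have : IsIso (Functor.whiskerLeft R adj.unit) := by
    have (e : B) : IsIso ((Functor.whiskerLeft R adj.unit).app e) := this e
    exact NatIso.isIso_of_isIso_app _
  let c₁ : i ⋙ (L ⋙ F) ≅ F ⋙ 𝟭 B := Functor.isoWhiskerRight (asIso adj.counit) F
  let c₂ : 𝟭 B ⋙ R ≅ (R ⋙ L) ⋙ i := asIso (Functor.whiskerLeft R adj.unit)
  exact ⟨R ⋙ L, ⟨adj'.restrictFullyFaithful (.ofFullyFaithful i) (.id B) c₁ c₂⟩⟩

end LeftAdjoint

section Adhesive

variable {C : Type u} [Category.{v} C] [Adhesive C]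

/-- In an adhesive category, the comparison map from the pushout of a pullback square of
monomorphisms is a monomorphism. -/
theorem Adhesive.mono_desc_of_isPullback {W X Y Z : C} {f : W ⟶ X} {g : W ⟶ Y} {a : X ⟶ Z}
    {b : Y ⟶ Z} [Mono a] [Mono b] (h : IsPullback f g a b) [HasPushout f g] :
    Mono (pushout.desc a b h.w) := by
  let e : pushout f g ⟶ pushout (pullback.fst a b) (pullback.snd a b) :=
    pushout.map _ _ _ _ (𝟙 _) (𝟙 _) h.isoPullback.hom (by simp) (by simp)
  have : pushout.desc a b h.w = e ≫ pushout.desc a b pullback.condition := by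
    apply pushout.hom_ext <;> simp [e, pushout.map, pushout.inl_desc, pushout.inr_desc,
      pushout.inl_desc_assoc, pushout.inr_desc_assoc]
  rw [this]
  infer_instance

/-- In an adhesive category, let `α : F ⟶ G` be a pointwise monic natural transformation where
`F` preserves pushouts. Its naturality square at a monomorphism `f` is a pullback if `G.map f` is
a monomorphism. -/
theorem Adhesive.isPullback_naturality {D : Type*} [Category* D] [Adhesive D] [HasPushouts C]
    {F G : C ⥤ D} (α : F ⟶ G) [∀ X, Mono (α.app X)]
    (hF : ∀ ⦃X Y : C⦄ (f : X ⟶ Y), Mono f →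
      IsPushout (F.map f) (F.map f) (F.map (pushout.inl f f)) (F.map (pushout.inr f f)))
    {X Y : C} (f : X ⟶ Y) [Mono f] [Mono (G.map f)] :
    IsPullback (α.app X) (F.map f) (G.map f) (α.app Y) := by
  have : Mono (F.map f ≫ α.app Y) := by
    rw [α.naturality]; infer_instance
  have : Mono (F.map f) := mono_of_mono (F.map f) (α.app Y)
  have hp := Adhesive.isPullback_of_isPushout_of_mono_left (hF f inferInstance)
  -- After composing with `α` at the pushout, both sides factor through `G.map f`, where the two
  -- coprojections agree.
  have hs (s : PullbackCone (G.map f) (α.app Y)) :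
      s.snd ≫ F.map (pushout.inl f f) = s.snd ≫ F.map (pushout.inr f f) := by
    rw [← cancel_mono (α.app _), Category.assoc, Category.assoc, α.naturality, α.naturality,
      ← s.condition_assoc, ← s.condition_assoc, ← G.map_comp, ← G.map_comp, pushout.condition]
  refine ⟨⟨(α.naturality f).symm⟩, ⟨PullbackCone.IsLimit.mk _
    (fun s => hp.lift s.snd s.snd (hs s)) (fun s => ?_) (fun s => ?_) (fun s m _ h₂ => ?_)⟩⟩
  · rw [← cancel_mono (G.map f), Category.assoc, ← α.naturality, IsPullback.lift_fst_assoc,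
      s.condition]
  · exact hp.lift_fst _ _ _
  · rw [← cancel_mono (F.map f), h₂, hp.lift_fst]

end Adhesive

end CategoryTheory

namespace IsGrothendieckTopos

variable (E : Type u) [Category.{v} E] [IsGrothendieckTopos.{v, u} E]

theorem adhesive : Adhesive E := by
  obtain ⟨C, _, J, ⟨e⟩⟩ := IsGrothendieckTopos.exists_equivalence_sheaf (E := E)
  have : HasPullbacks E := Adjunction.hasLimitsOfShape_of_equivalence e.functor
  exact adhesive_of_preserves_and_reflects_isomorphism e.functor

variable {E} in
/-- The special case of the adjoint functor theorem: cocontinuous functors out of a Grothendieck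
topos are left adjoints. -/
theorem isLeftAdjoint_of_preservesColimits {A : Type*} [Category.{v} A] [HasColimits A] (F : E ⥤ A)
    [PreservesColimits F] : F.IsLeftAdjoint := by
  obtain ⟨C, _, J, ⟨e⟩⟩ := IsGrothendieckTopos.exists_equivalence_sheaf (E := E)
  let adj := (sheafificationAdjunction J (Type v)).comp e.symm.toAdjunction
  have : PreservesColimits (presheafToSheaf J (Type v) ⋙ e.symm.functor) :=
    adj.leftAdjoint_preservesColimits
  -- On presheaves over a small category, a cocontinuous functor has a right adjoint given by homs
  -- out of the images of representables.
  have : ((presheafToSheaf J (Type v) ⋙ e.symm.functor) ⋙ F).IsLeftAdjoint :=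
    Presheaf.isLeftAdjoint_of_preservesColimits.{v} _
  exact Functor.isLeftAdjoint_of_reflector_comp adj F

end IsGrothendieckTopos

namespace CylinderTheory

theorem isPushout_coprod_map {K : Type u} [Category.{v} K] [HasBinaryCoproducts K] {W X Y Z : K}
    {f : W ⟶ X} {g : W ⟶ Y} {h : X ⟶ Z} {i : Y ⟶ Z} (H : IsPushout f g h i) :
    IsPushout (coprod.map f f) (coprod.map g g) (coprod.map h h) (coprod.map i i) := by
  have hl (s : PushoutCocone (coprod.map f f) (coprod.map g g)) :
      f ≫ coprod.inl ≫ s.inl = g ≫ coprod.inl ≫ s.inr := by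
    simpa only [coprod.inl_map_assoc] using coprod.inl ≫= s.condition
  have hr (s : PushoutCocone (coprod.map f f) (coprod.map g g)) :
      f ≫ coprod.inr ≫ s.inl = g ≫ coprod.inr ≫ s.inr := by
    simpa only [coprod.inr_map_assoc] using coprod.inr ≫= s.condition
  refine ⟨⟨by simp only [coprod.map_map, H.w]⟩, ⟨PushoutCocone.IsColimit.mk _
    (fun s => coprod.desc (H.desc _ _ (hl s)) (H.desc _ _ (hr s)))
    (fun s => ?_) (fun s => ?_) (fun s m h₁ h₂ => ?_)⟩⟩
  · apply coprod.hom_ext <;> simp [coprod.inl_desc, coprod.inr_desc]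
  · apply coprod.hom_ext <;> simp [coprod.inl_desc, coprod.inr_desc]
  · apply coprod.hom_ext <;> apply H.hom_ext <;>
      simp [coprod.inl_desc, coprod.inr_desc, ← h₁, ← h₂]

theorem mono_starMap {K : Type u} [Category.{v} K] [HasPushouts K] [Adhesive K]
    {F F' : K ⥤ K} (α : F ⟶ F') {X Y : K} (f : X ⟶ Y)
    [Mono (F'.map f)] [Mono (α.app Y)]
    (h : IsPullback (α.app X) (F.map f) (F'.map f) (α.app Y)) : Mono (starMap f α) :=
  Adhesive.mono_desc_of_isPullback h.flip

namespace FunctorialCylinder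

section

variable {K : Type u} [Category.{v} K] [HasBinaryCoproducts K] {C W : MorphismProperty K}
  (Z : FunctorialCylinder C W)

@[simp]
theorem γ₀_app_σ_app (X : K) : Z.γ₀.app X ≫ Z.σ.app X = 𝟙 X := by
  have h := coprod.inl ≫= Z.fac X
  rw [coprod.inl_desc] at h
  exact (Category.assoc _ _ _).trans h

@[simp]
theorem γ₁_app_σ_app (X : K) : Z.γ₁.app X ≫ Z.σ.app X = 𝟙 X := by
  have h := coprod.inr ≫= Z.fac X
  rw [coprod.inr_desc] at h
  exact (Category.assoc _ _ _).trans h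

instance mono_γ₀_app (X : K) : Mono (Z.γ₀.app X) :=
  (SplitMono.mk _ (Z.γ₀_app_σ_app X)).mono

instance mono_γ₁_app (X : K) : Mono (Z.γ₁.app X) :=
  (SplitMono.mk _ (Z.γ₁_app_σ_app X)).mono

end

section Adhesive

variable {K : Type u} [Category.{v} K] [HasBinaryCoproducts K] [HasPushouts K] [Adhesive K]
  {W : MorphismProperty K} (Z : FunctorialCylinder (MorphismProperty.monomorphisms K) W)

instance mono_γ_app (X : K) : Mono (Z.γ.app X) := Z.γ_mem X

variable {Z}

/-- `cyl f` is the cobase change of `f` along `γ⁰`, monic by adhesivity, followed by `f ⋆ γ⁰`. -/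
theorem IsCartesian.preservesMonomorphisms (h : Z.IsCartesian) :
    Z.cyl.PreservesMonomorphisms where
  preserves {X Y} f _ := by
    have : Mono (starMap f Z.γ₀) := h.star_γ₀ f ‹Mono f›
    have : Mono (pushout.inr ((𝟭 K).map f) (Z.γ₀.app X)) :=
      Adhesive.mono_of_isPushout_of_mono_left (f := f) (IsPushout.of_hasPushout f (Z.γ₀.app X))
    have hf : pushout.inr ((𝟭 K).map f) (Z.γ₀.app X) ≫ starMap f Z.γ₀ = Z.cyl.map f :=
      pushout.inr_desc _ _ _
    rw [← hf]
    exact mono_comp _ _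

variable (Z)

theorem dH2_of_preservesMonomorphisms [Z.cyl.PreservesMonomorphisms] : Z.DH2 := fun _ _ f _ =>
  ⟨Adhesive.isPullback_naturality Z.γ₀ (fun _ _ f _ => IsPushout.of_hasPushout f f) f,
    Adhesive.isPullback_naturality Z.γ₁ (fun _ _ f _ => IsPushout.of_hasPushout f f) f⟩

theorem dH3_of_preservesMonomorphisms [Z.cyl.PreservesMonomorphisms] : Z.DH3 := fun _ _ f _ =>
  -- Doubling preserves the required pushouts because coproducts commute with pushouts.
  Adhesive.isPullback_naturality Z.γ
    (fun _ _ f _ => isPushout_coprod_map (IsPushout.of_hasPushout f f)) f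

end Adhesive

end FunctorialCylinder

end CylinderTheory

theorem mainTheorem10 (E : Type u) [Category.{v} E] [IsGrothendieckTopos.{v, u} E]
    (Z : CylinderTheory.WFSCylinder (MorphismProperty.monomorphisms E)
      (MorphismProperty.monomorphisms E).rlp) :
    (Z.IsCartesian ↔ Z.DH1) ∧ (Z.IsCartesian → Z.DH2 ∧ Z.DH3) := by
  have := IsGrothendieckTopos.adhesive E
  refine ⟨⟨fun h => ⟨h.preservesMonomorphisms, ?_⟩, fun h => ?_⟩, fun h => ?_⟩
  · have := h.isLeftAdjoint
    exact (Adjunction.ofIsLeftAdjoint Z.cyl).leftAdjoint_preservesColimits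
  · have := h.preservesMonomorphisms
    have := h.preservesColimits
    have h₂ := Z.dH2_of_preservesMonomorphisms
    refine ⟨IsGrothendieckTopos.isLeftAdjoint_of_preservesColimits Z.cyl, ?_, ?_, ?_⟩ <;>
      intro X Y f hf <;> have : Mono f := hf
    · exact CylinderTheory.mono_starMap _ _ (Z.dH3_of_preservesMonomorphisms f hf)
    · exact CylinderTheory.mono_starMap _ _ (h₂ f hf).1
    · exact CylinderTheory.mono_starMap _ _ (h₂ f hf).2
  · have := h.preservesMonomorphisms
    exact ⟨Z.dH2_of_preservesMonomorphisms, Z.dH3_of_preservesMonomorphisms⟩
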